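/- Let $R$ be a $\{0,1\}$-valued random variable and $\mathbf X$ an $\mathbb R^p$-valued random vector, and put $\overrightarrow{\mathbf X}:=(1,\mathbf X^T)^T\in\mathbb R^{p+1}$ and $\pi_N:=\mathbb P(R=1)$. Assume that for some $\boldsymbol\gamma_0\in\mathbb R^{p+1}$ the offset logistic model holds: $$\mathbb E(R\mid\mathbf X)=\frac{\pi_N\exp(\overrightarrow{\mathbf X}^T\boldsymbol\gamma_0)}{1+\pi_N\exp(\overrightarrow{\mathbf X}^T\boldsymbol\gamma_0)}\quad\text{almost surely.}$$ Let $(R_i,\mathbf X_i)_{i=1}^N$ be independent copies of $(R,\mathbf X)$, let $\widehat\pi_N:=N^{-1}\sum_{i=1}^NR_i$, and for $a\ge0$ and $\boldsymbol\gamma\in\mathbb R^{p+1}$ let $$\ell_N(\boldsymbol\gamma;a):=-N^{-1}\sum_{i=1}^N\left[R_i\overrightarrow{\mathbf X}_i^T\boldsymbol\gamma-\log\{1+a\exp(\overrightarrow{\mathbf X}_i^T\boldsymbol\gamma)\}\right].$$ For a real random variable $Y$ let $\|Y\|_{\psi_2}:=\inf\{t>0:\mathbb E[\exp(Y^2/t^2)]\le2\}$.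 Suppose that $\|\overrightarrow{\mathbf X}^T\boldsymbol\gamma_0\|_{\psi_2}\le\sigma_{\boldsymbol\gamma_0}<\infty$ and $\max_{1\le j\le p+1}\|\overrightarrow{\mathbf X}(j)\|_{\psi_2}\le\sigma<\infty$. Then for all $t_1,t_2\ge0$ with $t_2<N\pi_N/9$, with probability at least $1-6\exp(-t_1)-2\exp(-t_2)$, $$\begin{aligned}\|\nabla_{\boldsymbol\gamma}\ell_N(\boldsymbol\gamma_0;\widehat\pi_N)\|_\infty\le{}&C_1(\pi_N+\pi_N^{1/2})\sqrt{\frac{t_1+\log(p+1)}{N}}+C_4\left\{\sqrt{\frac{t_2\pi_N}{N}}+\frac{t_2}{N}\right\}\\&+(C_2+C_3\pi_N)\frac{\sqrt{\log(2N)}\,\{t_1+\log(p+1)\}}{N},\end{aligned}$$ where $$C_1=62\exp(2\sigma_{\boldsymbol\gamma_0}+80\sigma_{\boldsymbol\gamma_0}^2+5\sigma^2),\qquad C_2=\tfrac92c_6\sigma,$$ $$C_3=\tfrac{56}9\exp(2\sigma_{\boldsymbol\gamma_0}+40\sigma_{\boldsymbol\gamma_0}^2+10\sigma^2),\qquad C_4=16\sqrt2\exp(2\sigma_{\boldsymbol\gamma_0}+40\sigma_{\boldsymbol\gamma_0}^2+10\sigma^2),$$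 and $c_6>0$ is an absolute constant. -/

import Mathlib

open MeasureTheory ProbabilityTheory
open scoped ENNReal NNReal

/-- The sub-Gaussian Orlicz norm `inf {t > 0 : E[exp(Y² / t²)] ≤ 2}`, with values in `[0, ∞]`
(the infimum of the empty set is `∞`). The expectation is the Lebesgue integral of a nonnegative
function, so that it is `∞` when the exponential moment does not exist. -/
noncomputable def psi2Norm {Ω : Type*} [MeasurableSpace Ω] (P : Measure Ω) (Y : Ω → ℝ) : ℝ≥0∞ :=
  sInf {s : ℝ≥0∞ | ∃ t : ℝ, 0 < t ∧
    ∫⁻ ω, ENNReal.ofReal (Real.exp ((Y ω) ^ 2 / t ^ 2)) ∂P ≤ 2 ∧ s = ENNReal.ofReal t}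

/-- The covariate vector with an intercept, `(1, x₁, …, x_p)`. -/
noncomputable def withIntercept {p : ℕ} (x : Fin p → ℝ) : EuclideanSpace ℝ (Fin (p + 1)) :=
  WithLp.toLp 2 (Fin.cons 1 x)

/-- The linear predictor: the Euclidean inner product of `(1, x)` and `γ`. -/
noncomputable def linPred {p : ℕ} (γ : EuclideanSpace ℝ (Fin (p + 1))) (x : Fin p → ℝ) : ℝ :=
  inner ℝ (withIntercept x) γ

/-- The offset logistic propensity score with offset `log a`, written as
`a exp(u) / (1 + a exp(u))` with `u` the linear predictor. -/
noncomputable def offsetPropensity {p : ℕ} (a : ℝ) (γ : EuclideanSpace ℝ (Fin (p + 1)))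
    (x : Fin p → ℝ) : ℝ :=
  a * Real.exp (linPred γ x) / (1 + a * Real.exp (linPred γ x))

/-- The offset logistic loss of the data `(r i, x i)`, `i < N`, with offset `log a`. -/
noncomputable def offsetLoss {N p : ℕ} (r : Fin N → ℝ) (x : Fin N → Fin p → ℝ) (a : ℝ)
    (γ : EuclideanSpace ℝ (Fin (p + 1))) : ℝ :=
  -((N : ℝ)⁻¹ * ∑ i, (r i * linPred γ (x i) - Real.log (1 + a * Real.exp (linPred γ (x i)))))

/-- The estimated labeling probability, the mean of the labeling indicators. -/
noncomputable def labelFraction {N : ℕ} (r : Fin N → ℝ) : ℝ := (N : ℝ)⁻¹ * ∑ i, r i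

/-- `‖∇_γ ℓ_N(γ; π̂_N)‖_∞`: the largest absolute coordinate of the gradient in `γ` of the loss,
the offset being held fixed at the estimated labeling probability
(the norm of `Fin (p + 1) → ℝ` is the sup norm). -/
noncomputable def gradSupNorm {N p : ℕ} (r : Fin N → ℝ) (x : Fin N → Fin p → ℝ)
    (γ : EuclideanSpace ℝ (Fin (p + 1))) : ℝ :=
  ‖WithLp.ofLp (gradient (offsetLoss r x (labelFraction r)) γ)‖

/-- The constant `C₁`; `s` bounds the Orlicz norm of the linear predictor, `σ` those of the
coordinates. -/
noncomputable def gradC1 (s σ : ℝ) : ℝ := 62 * Real.exp (2 * s + 80 * s ^ 2 + 5 * σ ^ 2)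

/-- The constant `C₂`, with `c` an absolute constant. -/
noncomputable def gradC2 (c σ : ℝ) : ℝ := 9 / 2 * c * σ

/-- The constant `C₃`. -/
noncomputable def gradC3 (s σ : ℝ) : ℝ := 56 / 9 * Real.exp (2 * s + 40 * s ^ 2 + 10 * σ ^ 2)

/-- The constant `C₄`. -/
noncomputable def gradC4 (s σ : ℝ) : ℝ :=
  16 * Real.sqrt 2 * Real.exp (2 * s + 40 * s ^ 2 + 10 * σ ^ 2)

/-- The bound on the gradient, with `a` the labeling probability `π_N`. -/
noncomputable def gradBound (c s σ : ℝ) (N p : ℕ) (a t₁ t₂ : ℝ) : ℝ :=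
  gradC1 s σ * (a + Real.sqrt a) * Real.sqrt ((t₁ + Real.log ((p : ℝ) + 1)) / N)
    + gradC4 s σ * (Real.sqrt (t₂ * a / N) + t₂ / N)
    + (gradC2 c σ + gradC3 s σ * a)
        * (Real.sqrt (Real.log (2 * (N : ℝ))) * (t₁ + Real.log ((p : ℝ) + 1)) / N)

/-! Write `g_b(x)` for the propensity with offset `log b`, `a` for the labeling probability and `â`
for its estimate. Coordinate `j` of the gradient is minus the mean of `(R_i - g_â(X_i)) X_i(j)`.
This is split into the score at the true offset and the error of replacing `a` by `â`. The
propensity is Lipschitz in relative terms, `|g_â - g_a| ≤ (|â - a| / a) g_a`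
(`abs_offsetPropensity_sub_le`), so the second part is at most the relative error of `â` times the
mean of `g_a(X_i) |X_i(j)|`.

The model centers the score. Both its second moment and that of `g_a |X(j)|` are of order `a`,
because `g_a ≤ a exp(u)` for the linear predictor `u`, and `exp(u) X(j)²` is integrable by
sub-Gaussianity. A Bernstein inequality with the true second moment as variance proxy
(`measureReal_sum_comp_ge_le_of_subgaussian`) therefore gives the rate `√(a τ / N)`; unboundedness
costs only `√log (2N)` in the linear term. It is applied three times per coordinate with `τ = t₁ +
log (p + 1)`, so that a union bound costs `3 exp(-t₁)`. A Chernoff bound for `â` costs `2 exp(-t₂)`.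
-/

/-! ### Exponential moments from the Orlicz norm. -/

section Orlicz

variable {Ω : Type*} [MeasurableSpace Ω] {P : Measure Ω} {Y : Ω → ℝ}

/-- A strict inequality supplies an admissible scale below `t`, and the moment decreases in the
scale. Whether the infimum is attained never matters. -/
lemma lintegral_exp_le_two_of_psi2Norm_lt {t : ℝ} (h : psi2Norm P Y < ENNReal.ofReal t) :
    ∫⁻ ω, ENNReal.ofReal (Real.exp ((Y ω) ^ 2 / t ^ 2)) ∂P ≤ 2 := by
  obtain ⟨s, ⟨t', ht', hint, rfl⟩, hs⟩ := sInf_lt_iff.1 h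
  have hlt : t' < t := (ENNReal.ofReal_lt_ofReal_iff_of_nonneg ht'.le).1 hs
  refine le_trans (lintegral_mono fun ω => ?_) hint
  gcongr

lemma integrable_exp_sq_div_of_psi2Norm_lt {t : ℝ} (hY : AEMeasurable Y P)
    (h : psi2Norm P Y < ENNReal.ofReal t) :
    Integrable (fun ω => Real.exp ((Y ω) ^ 2 / t ^ 2)) P := by
  refine ⟨by fun_prop, ?_⟩
  rw [hasFiniteIntegral_iff_ofReal (.of_forall fun _ => (Real.exp_pos _).le)]
  exact (lintegral_exp_le_two_of_psi2Norm_lt h).trans_lt (by simp)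

lemma integral_exp_sq_div_le_two_of_psi2Norm_lt {t : ℝ} (hY : AEMeasurable Y P)
    (h : psi2Norm P Y < ENNReal.ofReal t) :
    ∫ ω, Real.exp ((Y ω) ^ 2 / t ^ 2) ∂P ≤ 2 := by
  rw [integral_eq_lintegral_of_nonneg_ae (.of_forall fun _ => (Real.exp_pos _).le) (by fun_prop)]
  exact ENNReal.toReal_le_of_le_ofReal (by norm_num)
    (by simpa using lintegral_exp_le_two_of_psi2Norm_lt h)

/-- Applied to the intercept coordinate, this forces `σ ≥ 1`, which lets numerical constants be
absorbed into exponentials of `σ²`. -/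
lemma one_le_psi2Norm_one [IsProbabilityMeasure P] : 1 ≤ psi2Norm P (fun _ => 1) := by
  refine le_sInf ?_
  rintro s ⟨t, ht, hint, rfl⟩
  rw [← ENNReal.ofReal_one]
  refine ENNReal.ofReal_le_ofReal ?_
  by_contra! hlt
  simp only [one_pow, lintegral_const, measure_univ, mul_one] at hint
  have h2 : Real.exp (1 / t ^ 2) ≤ 2 := by
    have := (ENNReal.ofReal_le_iff_le_toReal (by simp)).1 hint
    simpa using this
  have h3 : 1 < 1 / t ^ 2 := by
    rw [lt_div_iff₀ (by positivity)]
    nlinarith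
  linarith [Real.add_one_le_exp (1 / t ^ 2)]

end Orlicz

/-! ### Chernoff and Bernstein inequalities for independent copies. -/

section Chernoff

variable {Ω Ω' E : Type*} [MeasurableSpace Ω] [MeasurableSpace Ω'] [MeasurableSpace E]
  {P : Measure Ω} {P' : Measure Ω'}

/-- The Chernoff bound for a function of independent copies of a random element. -/
lemma measureReal_sum_comp_ge_le [IsProbabilityMeasure P'] {N : ℕ} {Z : Fin N → Ω' → E}
    {Z₀ : Ω → E} (hindep : iIndepFun Z P') (hident : ∀ i, IdentDistrib (Z i) Z₀ P' P)
    {φ : E → ℝ} (hφ : Measurable φ) {l c : ℝ} (hl : 0 ≤ l)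
    (hint : Integrable (fun ω => Real.exp (l * φ (Z₀ ω))) P)
    (hmgf : ∫ ω, Real.exp (l * φ (Z₀ ω)) ∂P ≤ Real.exp c) (ε : ℝ) :
    P'.real {ω | ε ≤ ∑ i, φ (Z i ω)} ≤ Real.exp (-l * ε + N * c) := by
  have hind : iIndepFun (fun i ω => φ (Z i ω)) P' := hindep.comp (fun _ => φ) fun _ => hφ
  have hid (i) : IdentDistrib (fun ω => φ (Z i ω)) (fun ω => φ (Z₀ ω)) P' P :=
    (hident i).comp hφ
  have hm (i) : AEMeasurable (fun ω => φ (Z i ω)) P' := (hid i).aemeasurable_fst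
  have hint' (i) : Integrable (fun ω => Real.exp (l * φ (Z i ω))) P' :=
    (((hid i).comp (u := fun x => Real.exp (l * x)) (by fun_prop)).integrable_iff).2 hint
  have hmg (i) : mgf (fun ω => φ (Z i ω)) P' l ≤ Real.exp c := by
    rw [mgf_congr_of_identDistrib _ _ (hid i)]
    exact hmgf
  have hsum : Integrable (fun ω => Real.exp (l * (∑ i, fun ω => φ (Z i ω)) ω)) P' := by
    -- The Bochner integral of a non-integrable function is zero, while here it is a product of
    -- positive moment generating functions.
    refine .of_integral_ne_zero ?_
    change mgf _ P' l ≠ 0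
    rw [hind.mgf_sum₀ hm]
    exact Finset.prod_ne_zero_iff.2 fun i _ => (mgf_pos (hint' i)).ne'
  have h1 := measure_ge_le_exp_mul_mgf (μ := P') ε hl hsum
  rw [hind.mgf_sum₀ hm] at h1
  have h2 : ∏ i : Fin N, mgf (fun ω => φ (Z i ω)) P' l ≤ Real.exp c ^ N := by
    refine (Finset.prod_le_prod (fun i _ => mgf_nonneg) fun i _ => hmg i).trans ?_
    simp
  simp only [Finset.sum_apply] at h1
  refine h1.trans ?_
  rw [Real.exp_add, Real.exp_nat_mul]
  gcongr

/-- The optimization of the sub-gamma Chernoff exponent. -/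
lemma exists_chernoff_exponent_le {A B τ : ℝ} (hA : 0 < A) (hB : 0 < B) (hτ : 0 ≤ τ) :
    ∃ l, 0 ≤ l ∧ l * B ≤ 1 ∧ -l * (2 * √(A * τ) + B * τ) + l ^ 2 * A ≤ -τ := by
  have hsA := Real.sq_sqrt hA.le
  have hsτ := Real.sq_sqrt hτ
  have hpA : 0 < √A := Real.sqrt_pos.2 hA
  have hnτ : 0 ≤ √τ := Real.sqrt_nonneg _
  rw [Real.sqrt_mul hA.le]
  set x := √A
  set y := √τ
  rw [← hsA, ← hsτ]
  -- The witness is the smaller of the unconstrained choice `√(τ / A)` and the cap `1 / B`.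
  rcases le_total (y * B) x with h | h
  · refine ⟨y / x, by positivity, ?_, ?_⟩
    · rw [div_mul_eq_mul_div, div_le_one hpA]
      exact h
    · have : -(y / x) * (2 * (x * y) + B * y ^ 2) + (y / x) ^ 2 * x ^ 2
          = -y ^ 2 - y / x * (B * y ^ 2) := by field_simp; ring
      rw [this]
      have : 0 ≤ y / x * (B * y ^ 2) := by positivity
      linarith
  · refine ⟨1 / B, by positivity, by field_simp; exact le_rfl, ?_⟩
    have : -(1 / B) * (2 * (x * y) + B * y ^ 2) + (1 / B) ^ 2 * x ^ 2
        = -y ^ 2 - (x / B ^ 2) * (2 * (y * B) - x) := by field_simp; ring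
    rw [this]
    have : 0 ≤ (x / B ^ 2) * (2 * (y * B) - x) := mul_nonneg (by positivity) (by linarith)
    linarith

/-- If `|l w| ≤ 1`, a second-order Taylor bound suffices. If `l w < -1`, the exponential is at most
one. If `l w > 1`, then `|x| > B`, and the excess is a small fraction of `exp(x² / K²)`: the
threshold `B` is chosen so that `exp(x² / (2 K²))` already beats `4 n`. After integration the last
term is of order `K² / n` and sums to a constant over a sample of size `n`. -/
lemma exp_mul_le_of_abs_le {l B K n w x : ℝ} (hl : 0 ≤ l) (hB : 0 < B) (hlB : l * B ≤ 1)
    (hK : 0 < K) (hn : 1 ≤ n) (hBK : B ^ 2 = 8 * K ^ 2 * Real.log (2 * n)) (hwx : |w| ≤ |x|) :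
    Real.exp (l * w) ≤ 1 + l * w + l ^ 2 * (2 * w ^ 2 + K ^ 2 * Real.exp (x ^ 2 / K ^ 2) / n) := by
  have hlog : 1 / 2 < Real.log (2 * n) := by
    have := Real.log_le_log (by norm_num) (show (2 : ℝ) ≤ 2 * n by linarith)
    linarith [Real.log_two_gt_d9]
  have hrem : 0 ≤ l ^ 2 * (K ^ 2 * Real.exp (x ^ 2 / K ^ 2) / n) := by positivity
  have hrem' : 0 ≤ l ^ 2 * w ^ 2 := by positivity
  by_cases h1 : |l * w| ≤ 1
  · have := (abs_le.1 (Real.abs_exp_sub_one_sub_id_le h1)).2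
    nlinarith
  · rcases le_total (l * w) 0 with h2 | h2
    · rw [abs_of_nonpos h2] at h1
      have := Real.exp_le_one_iff.2 h2
      nlinarith
    · rw [abs_of_nonneg h2] at h1
      push Not at h1
      have hw : l * w ≤ l * |x| := mul_le_mul_of_nonneg_left ((le_abs_self w).trans hwx) hl
      have hlpos : 0 < l := lt_of_le_of_ne hl (by rintro rfl; norm_num at h1)
      have hBx : B < |x| := by
        by_contra! h
        have := mul_le_mul_of_nonneg_left h hl
        linarith
      have hBx2 : B ^ 2 ≤ x ^ 2 := by
        rw [← sq_abs x]; gcongr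
      -- From `l B ≤ 1` and `B < |x|` follows `l |x| ≤ x² / B²`, and `B² ≥ 4 K²` because `log (2n) >
      -- 1/2`.
      have h4 : l * w ≤ x ^ 2 / (4 * K ^ 2) := by
        have e1 : l * |x| ≤ x ^ 2 / B ^ 2 := by
          rw [le_div_iff₀ (by positivity), ← sq_abs x]
          calc l * |x| * B ^ 2 = (l * B) * (|x| * B) := by ring
            _ ≤ 1 * (|x| * |x|) := by gcongr
            _ = |x| ^ 2 := by ring
        refine (hw.trans e1).trans ?_
        gcongr
        nlinarith [sq_pos_of_pos hK]
      have h5 : x ^ 2 ≤ 4 * K ^ 2 * Real.exp (x ^ 2 / (4 * K ^ 2)) := by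
        have := Real.add_one_le_exp (x ^ 2 / (4 * K ^ 2))
        have h6 : x ^ 2 = 4 * K ^ 2 * (x ^ 2 / (4 * K ^ 2)) := by field_simp
        calc x ^ 2 = 4 * K ^ 2 * (x ^ 2 / (4 * K ^ 2)) := h6
          _ ≤ _ := by gcongr; linarith
      have h7 : 4 * n ≤ Real.exp (x ^ 2 / (2 * K ^ 2)) := by
        have e1 : 2 * Real.log (2 * n) ≤ x ^ 2 / (2 * K ^ 2) := by
          rw [le_div_iff₀ (by positivity)]
          nlinarith [sq_pos_of_pos hK]
        have e2 : Real.exp (2 * Real.log (2 * n)) = (2 * n) ^ 2 := by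
          rw [two_mul, Real.exp_add, Real.exp_log (by positivity)]; ring
        have := Real.exp_le_exp.2 e1
        rw [e2] at this
        nlinarith
      have hsplit : Real.exp (x ^ 2 / K ^ 2) = Real.exp (x ^ 2 / (4 * K ^ 2)) *
          Real.exp (x ^ 2 / (4 * K ^ 2)) * Real.exp (x ^ 2 / (2 * K ^ 2)) := by
        rw [← Real.exp_add, ← Real.exp_add]
        congr 1
        field_simp
        ring
      have h8 : x ^ 2 * Real.exp (x ^ 2 / (4 * K ^ 2)) ≤
          K ^ 2 * Real.exp (x ^ 2 / K ^ 2) / n := by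
        rw [le_div_iff₀ (by positivity), hsplit]
        set e := Real.exp (x ^ 2 / (4 * K ^ 2))
        calc x ^ 2 * e * n ≤ 4 * K ^ 2 * e * e * n := by gcongr
          _ = K ^ 2 * (e * e * (4 * n)) := by ring
          _ ≤ _ := by gcongr
      have h9 : Real.exp (l * w) ≤ l ^ 2 * (x ^ 2 * Real.exp (x ^ 2 / (4 * K ^ 2))) := by
        have e1 := Real.exp_le_exp.2 h4
        have e2 : 1 ≤ l ^ 2 * x ^ 2 := by
          rw [← mul_pow, ← sq_abs, abs_mul, abs_of_pos hlpos]
          exact one_le_pow₀ (h1.le.trans hw)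
        calc Real.exp (l * w) ≤ 1 * Real.exp (x ^ 2 / (4 * K ^ 2)) := by linarith
          _ ≤ l ^ 2 * x ^ 2 * Real.exp (x ^ 2 / (4 * K ^ 2)) := by gcongr
          _ = _ := by ring
      have := mul_le_mul_of_nonneg_left h8 (sq_nonneg l)
      nlinarith

/-- A Bernstein inequality for independent copies of a sub-Gaussian variable: the variance proxy is
the second moment, and the sub-Gaussian scale enters with a factor `√log (2N)` in the linear
term. -/
lemma measureReal_sum_comp_ge_le_of_subgaussian [IsProbabilityMeasure P] [IsProbabilityMeasure P']
    {N : ℕ} (hN : 1 ≤ N) {Z : Fin N → Ω' → E}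
    {Z₀ : Ω → E} (hindep : iIndepFun Z P') (hident : ∀ i, IdentDistrib (Z i) Z₀ P' P)
    {φ : E → ℝ} (hφ : Measurable φ) {V : Ω → ℝ}
    {K v m τ : ℝ} (hK : 0 < K) (hV : Integrable (fun ω => Real.exp ((V ω) ^ 2 / K ^ 2)) P)
    (hV2 : ∫ ω, Real.exp ((V ω) ^ 2 / K ^ 2) ∂P ≤ 2) (hφV : ∀ᵐ ω ∂P, |φ (Z₀ ω)| ≤ |V ω|)
    (hi : Integrable (fun ω => φ (Z₀ ω)) P) (hi2 : Integrable (fun ω => φ (Z₀ ω) ^ 2) P)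
    (hm : ∫ ω, φ (Z₀ ω) ∂P ≤ m) (hv : ∫ ω, φ (Z₀ ω) ^ 2 ∂P ≤ v) (hτ : 0 ≤ τ) :
    P'.real {ω | N * m + (2 * √((2 * N * v + 2 * K ^ 2) * τ)
      + K * √(8 * Real.log (2 * N)) * τ) ≤ ∑ i, φ (Z i ω)} ≤ Real.exp (-τ) := by
  have hN' : (1 : ℝ) ≤ N := by exact_mod_cast hN
  have hlog : 0 < Real.log (2 * N) := Real.log_pos (by linarith)
  set B := K * √(8 * Real.log (2 * N)) with hB
  have hBpos : 0 < B := by positivity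
  have hBK : B ^ 2 = 8 * K ^ 2 * Real.log (2 * N) := by
    rw [hB, mul_pow, Real.sq_sqrt (by positivity)]; ring
  have hv0 : 0 ≤ v := (integral_nonneg fun ω => sq_nonneg _).trans hv
  -- `A` is `N` times the coefficient of `l²` in the bound `hmgf` on the logarithmic moment
  -- generating function.
  obtain ⟨l, hl, hlB, hle⟩ := exists_chernoff_exponent_le
    (A := 2 * N * v + 2 * K ^ 2) (by positivity) hBpos hτ
  have hpt : ∀ᵐ ω ∂P, Real.exp (l * φ (Z₀ ω)) ≤ 1 + l * φ (Z₀ ω) +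
      l ^ 2 * (2 * φ (Z₀ ω) ^ 2 + K ^ 2 * Real.exp ((V ω) ^ 2 / K ^ 2) / N) := by
    filter_upwards [hφV] with ω hω
    exact exp_mul_le_of_abs_le hl hBpos hlB hK hN' hBK hω
  have hI1 : Integrable (fun ω => 1 + l * φ (Z₀ ω)) P := (integrable_const 1).add (hi.const_mul l)
  have hI2 : Integrable (fun ω => 2 * φ (Z₀ ω) ^ 2) P := hi2.const_mul 2
  have hI3 : Integrable (fun ω => K ^ 2 * Real.exp ((V ω) ^ 2 / K ^ 2) / N) P :=
    (hV.const_mul _).div_const _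
  have hI4 : Integrable (fun ω => l ^ 2 * (2 * φ (Z₀ ω) ^ 2 +
      K ^ 2 * Real.exp ((V ω) ^ 2 / K ^ 2) / N)) P := (hI2.add hI3).const_mul _
  have hint : Integrable (fun ω => Real.exp (l * φ (Z₀ ω))) P := by
    refine (hI1.add hI4).mono'
      (hi.aestronglyMeasurable.const_mul l).aemeasurable.exp.aestronglyMeasurable ?_
    filter_upwards [hpt] with ω hω
    rw [Real.norm_eq_abs, abs_of_pos (Real.exp_pos _)]
    exact hω
  have hmgf : ∫ ω, Real.exp (l * φ (Z₀ ω)) ∂P ≤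
      Real.exp (l * m + l ^ 2 * (2 * v + 2 * K ^ 2 / N)) := by
    have h2 : ∫ ω, ((1 + l * φ (Z₀ ω)) + l ^ 2 * (2 * φ (Z₀ ω) ^ 2 +
        K ^ 2 * Real.exp ((V ω) ^ 2 / K ^ 2) / N)) ∂P = 1 + l * ∫ ω, φ (Z₀ ω) ∂P +
        l ^ 2 * (2 * ∫ ω, φ (Z₀ ω) ^ 2 ∂P +
          K ^ 2 * (∫ ω, Real.exp ((V ω) ^ 2 / K ^ 2) ∂P) / N) := by
      rw [integral_add hI1 hI4, integral_add (integrable_const _) (hi.const_mul l),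
        integral_const_mul, integral_const_mul, integral_add hI2 hI3, integral_const_mul,
        integral_div, integral_const_mul]
      simp
    have h1 := (integral_mono_ae hint (hI1.add hI4) hpt).trans_eq h2
    refine h1.trans (le_trans ?_ (Real.add_one_le_exp _))
    have h3 : l * ∫ ω, φ (Z₀ ω) ∂P ≤ l * m := by gcongr
    have h4 : l ^ 2 * (2 * ∫ ω, φ (Z₀ ω) ^ 2 ∂P +
        K ^ 2 * (∫ ω, Real.exp ((V ω) ^ 2 / K ^ 2) ∂P) / N) ≤ l ^ 2 * (2 * v + K ^ 2 * 2 / N) := by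
      gcongr
    rw [mul_comm (K ^ 2) 2] at h4
    linarith
  refine (measureReal_sum_comp_ge_le hindep hident hφ hl hint hmgf _).trans ?_
  refine Real.exp_le_exp.2 (le_trans (le_of_eq ?_) hle)
  field_simp
  ring

/-- The Chernoff bound for the deviation of a mean of independent Bernoulli variables. -/
lemma measureReal_sum_bernoulli_ge_le [IsProbabilityMeasure P] [IsProbabilityMeasure P']
    {N : ℕ} {Z : Fin N → Ω' → E} {Z₀ : Ω → E} (hindep : iIndepFun Z P')
    (hident : ∀ i, IdentDistrib (Z i) Z₀ P' P)
    {φ : E → ℝ} (hφ : Measurable φ) (h01 : ∀ᵐ ω ∂P, φ (Z₀ ω) = 0 ∨ φ (Z₀ ω) = 1)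
    (hi : Integrable (fun ω => φ (Z₀ ω)) P) {a t s : ℝ} (ha : ∫ ω, φ (Z₀ ω) ∂P = a)
    (ht : 0 ≤ t) (hta : t < N * a) (hs : s = 1 ∨ s = -1) :
    P'.real {ω | 2 * √(N * a * t) ≤ ∑ i, s * (φ (Z i ω) - a)} ≤ Real.exp (-t) := by
  have hNa : 0 < N * a := ht.trans_lt hta
  have ha0 : 0 ≤ a := by
    by_contra! h
    exact absurd hNa (not_lt.2 (mul_nonpos_of_nonneg_of_nonpos (by positivity) h.le))
  -- This minimizes `-2 l √(N a t) + N a l²`, with value `-t`; the assumption `t < N a` gives `l ≤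
  -- 1`, as the quadratic bound on the exponential requires.
  set l := √(t / (N * a)) with hldef
  have hl : 0 ≤ l := Real.sqrt_nonneg _
  have hl2 : l ^ 2 = t / (N * a) := Real.sq_sqrt (by positivity)
  have hl1 : l ≤ 1 := by
    rw [hldef, Real.sqrt_le_one, div_le_one hNa]
    exact hta.le
  have hls : |l * s| ≤ 1 := by
    rcases hs with rfl | rfl <;> simp [abs_of_nonneg hl, hl1]
  have hss : s ^ 2 = 1 := by rcases hs with rfl | rfl <;> norm_num
  have hpt : (fun ω => Real.exp (l * (s * (φ (Z₀ ω) - a)))) =ᵐ[P]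
      fun ω => Real.exp (-(l * s * a)) * (1 + φ (Z₀ ω) * (Real.exp (l * s) - 1)) := by
    filter_upwards [h01] with ω hω
    rcases hω with h | h <;> rw [h]
    · simp; ring_nf
    · rw [one_mul, add_sub_cancel, ← Real.exp_add]; ring_nf
  have hI : Integrable (fun ω => 1 + φ (Z₀ ω) * (Real.exp (l * s) - 1)) P :=
    (integrable_const 1).add (hi.mul_const _)
  have hmgf : ∫ ω, Real.exp (l * (s * (φ (Z₀ ω) - a))) ∂P ≤ Real.exp (a * l ^ 2) := by
    rw [integral_congr_ae hpt, integral_const_mul,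
      integral_add (integrable_const _) (hi.mul_const _), integral_mul_const, ha]
    simp only [integral_const, probReal_univ, smul_eq_mul, mul_one]
    have h1 := (abs_le.1 (Real.abs_exp_sub_one_sub_id_le hls)).2
    have h2 : 1 + a * (Real.exp (l * s) - 1) ≤ Real.exp (a * (l * s + l ^ 2)) := by
      refine le_trans ?_ (Real.add_one_le_exp _)
      rw [mul_pow, hss] at h1
      nlinarith
    calc _ ≤ Real.exp (-(l * s * a)) * Real.exp (a * (l * s + l ^ 2)) := by gcongr
      _ = _ := by rw [← Real.exp_add]; ring_nf
  have := measureReal_sum_comp_ge_le hindep hident (φ := fun z => s * (φ z - a)) (by fun_prop) hl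
    ((integrable_congr hpt).2 (hI.const_mul _)) hmgf (2 * √(N * a * t))
  refine this.trans (Real.exp_le_exp.2 (le_of_eq ?_))
  have h3 : l * √(N * a * t) = t := by
    rw [hldef, ← Real.sqrt_mul (by positivity), ← mul_assoc,
      div_mul_cancel₀ _ hNa.ne', ← pow_two, Real.sqrt_sq ht]
  have h4 : N * (a * l ^ 2) = t := by
    rw [hl2, ← mul_assoc, mul_div_cancel₀ _ hNa.ne']
  linarith

end Chernoff

/-! ### The offset logistic model: gradient of the loss and dependence on the offset. -/

section OffsetLogistic

variable {N p : ℕ}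

@[simp] lemma withIntercept_zero (x : Fin p → ℝ) : withIntercept x 0 = 1 := rfl

@[simp] lemma withIntercept_succ (x : Fin p → ℝ) (i : Fin p) : withIntercept x i.succ = x i := rfl

lemma measurable_withIntercept_apply (j : Fin (p + 1)) :
    Measurable fun x : Fin p → ℝ => withIntercept x j := by
  cases j using Fin.cases with
  | zero => simp
  | succ i => simpa using measurable_pi_apply i

lemma measurable_linPred (γ : EuclideanSpace ℝ (Fin (p + 1))) : Measurable (linPred γ) := by
  have h : linPred γ = fun x => ∑ j, γ j * withIntercept x j := by
    ext x
    simp [linPred, PiLp.inner_apply]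
  rw [h]
  exact Finset.measurable_sum _ fun j _ => (measurable_withIntercept_apply j).const_mul _

lemma measurable_offsetPropensity (a : ℝ) (γ : EuclideanSpace ℝ (Fin (p + 1))) :
    Measurable (offsetPropensity a γ) := by
  have := measurable_linPred γ
  unfold offsetPropensity
  fun_prop

lemma offsetPropensity_nonneg {a : ℝ} (ha : 0 ≤ a) (γ : EuclideanSpace ℝ (Fin (p + 1)))
    (x : Fin p → ℝ) : 0 ≤ offsetPropensity a γ x := by
  unfold offsetPropensity
  positivity

lemma offsetPropensity_le_one {a : ℝ} (ha : 0 ≤ a) (γ : EuclideanSpace ℝ (Fin (p + 1)))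
    (x : Fin p → ℝ) : offsetPropensity a γ x ≤ 1 := by
  unfold offsetPropensity
  rw [div_le_one (by positivity)]
  linarith

lemma offsetPropensity_le_mul_exp {a : ℝ} (ha : 0 ≤ a) (γ : EuclideanSpace ℝ (Fin (p + 1)))
    (x : Fin p → ℝ) : offsetPropensity a γ x ≤ a * Real.exp (linPred γ x) := by
  unfold offsetPropensity
  refine div_le_self (by positivity) ?_
  have : 0 ≤ a * Real.exp (linPred γ x) := by positivity
  linarith

/-- The difference factors exactly as `(a - b) / b` times the propensity at `b` times `1 / (1 + a e)
≤ 1`. Keeping the propensity as a factor preserves its smallness when `b` is small. -/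
lemma abs_offsetPropensity_sub_le {a b : ℝ} (ha : 0 ≤ a) (hb : 0 < b)
    (γ : EuclideanSpace ℝ (Fin (p + 1))) (x : Fin p → ℝ) :
    |offsetPropensity a γ x - offsetPropensity b γ x| ≤ |a - b| / b * offsetPropensity b γ x := by
  unfold offsetPropensity
  set e := Real.exp (linPred γ x)
  have he : 0 < e := Real.exp_pos _
  have h1 : a * e / (1 + a * e) - b * e / (1 + b * e) =
      ((a - b) / b * (b * e / (1 + b * e))) * (1 / (1 + a * e)) := by
    field_simp
    ring
  have h2 : 0 ≤ b * e / (1 + b * e) := by positivity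
  rw [h1, abs_mul, abs_mul, abs_div, abs_of_pos hb, abs_of_nonneg h2]
  refine mul_le_of_le_one_right (by positivity) ?_
  rw [abs_of_nonneg (by positivity), div_le_one (by positivity)]
  have : 0 ≤ a * e := by positivity
  linarith

lemma hasGradientAt_offsetLoss (r : Fin N → ℝ) (x : Fin N → Fin p → ℝ) {a : ℝ} (ha : 0 ≤ a)
    (γ : EuclideanSpace ℝ (Fin (p + 1))) :
    HasGradientAt (offsetLoss r x a)
      (-((N : ℝ)⁻¹ • ∑ i, (r i - offsetPropensity a γ (x i)) • withIntercept (x i))) γ := by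
  rw [hasGradientAt_iff_hasFDerivAt]
  have hlin (i) : HasFDerivAt (fun γ => linPred γ (x i)) (innerSL ℝ (withIntercept (x i))) γ :=
    (innerSL ℝ (withIntercept (x i))).hasFDerivAt
  have hlog (i) : HasFDerivAt (fun γ => Real.log (1 + a * Real.exp (linPred γ (x i))))
      (offsetPropensity a γ (x i) • innerSL ℝ (withIntercept (x i))) γ := by
    have hpos : 0 < 1 + a * Real.exp (linPred γ (x i)) := by positivity
    refine ((((hlin i).exp.const_mul a).const_add 1).log hpos.ne').congr_fderiv ?_
    rw [smul_smul, smul_smul]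
    congr 1
    unfold offsetPropensity
    field_simp
  have hsum := ((HasFDerivAt.fun_sum (u := Finset.univ) fun i _ =>
    ((hlin i).const_mul (r i)).sub (hlog i)).const_mul (N : ℝ)⁻¹).neg
  refine HasFDerivAt.congr_fderiv (f := offsetLoss r x a) hsum ?_
  ext v
  simp [sub_mul]

lemma gradSupNorm_le {r : Fin N → ℝ} {x : Fin N → Fin p → ℝ}
    {γ : EuclideanSpace ℝ (Fin (p + 1))} {C : ℝ} (ha : 0 ≤ labelFraction r)
    (h : ∀ j, |(N : ℝ)⁻¹ * ∑ i, (r i - offsetPropensity (labelFraction r) γ (x i)) *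
      withIntercept (x i) j| ≤ C) :
    gradSupNorm r x γ ≤ C := by
  have hC : 0 ≤ C := (abs_nonneg _).trans (h 0)
  rw [gradSupNorm, (hasGradientAt_offsetLoss r x ha γ).gradient, pi_norm_le_iff_of_nonneg hC]
  intro j
  simpa using h j

/-- The effect of replacing the offset `b` by `a` in a coordinate of the score. -/
lemma abs_score_le {r y : Fin N → ℝ} {x : Fin N → Fin p → ℝ} {γ : EuclideanSpace ℝ (Fin (p + 1))}
    {a b D D' δ : ℝ} (hN : 0 < N) (ha : 0 ≤ a) (hb : 0 < b)
    (h1 : |∑ i, (r i - offsetPropensity b γ (x i)) * y i| ≤ N * D)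
    (h2 : ∑ i, offsetPropensity b γ (x i) * |y i| ≤ N * D') (h3 : |a - b| ≤ δ * b) :
    |(N : ℝ)⁻¹ * ∑ i, (r i - offsetPropensity a γ (x i)) * y i| ≤ D + δ * D' := by
  have hN' : (0 : ℝ) < N := by exact_mod_cast hN
  have hδ : 0 ≤ δ := nonneg_of_mul_nonneg_left ((abs_nonneg _).trans h3) hb
  rw [abs_mul, abs_of_pos (by positivity), inv_mul_le_iff₀ hN']
  have hsplit : ∑ i, (r i - offsetPropensity a γ (x i)) * y i =
      ∑ i, (r i - offsetPropensity b γ (x i)) * y i -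
        ∑ i, (offsetPropensity a γ (x i) - offsetPropensity b γ (x i)) * y i := by
    rw [← Finset.sum_sub_distrib]
    exact Finset.sum_congr rfl fun i _ => by ring
  have h4 : |∑ i, (offsetPropensity a γ (x i) - offsetPropensity b γ (x i)) * y i| ≤
      δ * ∑ i, offsetPropensity b γ (x i) * |y i| := by
    rw [Finset.mul_sum]
    refine (Finset.abs_sum_le_sum_abs _ _).trans (Finset.sum_le_sum fun i _ => ?_)
    rw [abs_mul, ← mul_assoc]
    refine mul_le_mul_of_nonneg_right ((abs_offsetPropensity_sub_le ha hb γ (x i)).trans ?_)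
      (abs_nonneg _)
    refine mul_le_mul_of_nonneg_right ?_ (offsetPropensity_nonneg hb.le γ _)
    rwa [div_le_iff₀ hb]
  rw [hsplit]
  refine (abs_sub _ _).trans ?_
  have h5 := mul_le_mul_of_nonneg_left h2 hδ
  nlinarith

end OffsetLogistic

/-! ### Exponential moments of products. -/

section Moments

/-- Only half of the available exponent is spent on each factor of a product, so that the
arithmetic-geometric mean inequality recombines the two halves without independence. -/
lemma exp_le_exp_half_mul {S : ℝ} (hS : 0 < S) (u : ℝ) :
    Real.exp u ≤ Real.exp (S ^ 2 / 2) * Real.exp (u ^ 2 / S ^ 2 / 2) := by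
  rw [← Real.exp_add]
  refine Real.exp_le_exp.2 ?_
  have h : S ^ 2 / 2 + u ^ 2 / S ^ 2 / 2 - u = (S - u / S) ^ 2 / 2 := by field_simp; ring
  have := sq_nonneg (S - u / S)
  linarith

lemma exp_half_mul_exp_half_le (x y : ℝ) :
    Real.exp (x / 2) * Real.exp (y / 2) ≤ (Real.exp x + Real.exp y) / 2 := by
  have hx : Real.exp x = Real.exp (x / 2) ^ 2 := by rw [← Real.exp_nat_mul]; ring_nf
  have hy : Real.exp y = Real.exp (y / 2) ^ 2 := by rw [← Real.exp_nat_mul]; ring_nf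
  rw [hx, hy]
  nlinarith [sq_nonneg (Real.exp (x / 2) - Real.exp (y / 2))]

lemma exp_mul_sq_le {S K : ℝ} (hS : 0 < S) (hK : 0 < K) (u y : ℝ) :
    Real.exp u * y ^ 2 ≤ K ^ 2 * Real.exp (S ^ 2 / 2) *
      (Real.exp (u ^ 2 / S ^ 2) + Real.exp (y ^ 2 / K ^ 2)) := by
  have h1 : y ^ 2 ≤ 2 * K ^ 2 * Real.exp (y ^ 2 / K ^ 2 / 2) := by
    have := Real.add_one_le_exp (y ^ 2 / K ^ 2 / 2)
    calc y ^ 2 = 2 * K ^ 2 * (y ^ 2 / K ^ 2 / 2) := by field_simp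
      _ ≤ _ := by gcongr; linarith
  have h2 := exp_half_mul_exp_half_le (u ^ 2 / S ^ 2) (y ^ 2 / K ^ 2)
  calc Real.exp u * y ^ 2 ≤ Real.exp (S ^ 2 / 2) * Real.exp (u ^ 2 / S ^ 2 / 2) *
        (2 * K ^ 2 * Real.exp (y ^ 2 / K ^ 2 / 2)) := by
        gcongr
        exact exp_le_exp_half_mul hS u
    _ = 2 * K ^ 2 * Real.exp (S ^ 2 / 2) *
        (Real.exp (u ^ 2 / S ^ 2 / 2) * Real.exp (y ^ 2 / K ^ 2 / 2)) := by ring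
    _ ≤ 2 * K ^ 2 * Real.exp (S ^ 2 / 2) *
        ((Real.exp (u ^ 2 / S ^ 2) + Real.exp (y ^ 2 / K ^ 2)) / 2) := by gcongr
    _ = _ := by ring

lemma exp_mul_abs_le {S K : ℝ} (hS : 0 < S) (hK : 0 < K) (u y : ℝ) :
    Real.exp u * |y| ≤ K / 2 * Real.exp (S ^ 2 / 2) *
      (Real.exp (u ^ 2 / S ^ 2) + Real.exp (y ^ 2 / K ^ 2)) := by
  have h1 : |y| ≤ K * Real.exp (y ^ 2 / K ^ 2 / 2) := by
    have := Real.add_one_le_exp (y ^ 2 / K ^ 2 / 2)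
    have h3 : |y| / K ≤ y ^ 2 / K ^ 2 / 2 + 1 := by
      rw [← sq_abs y, ← div_pow]
      nlinarith [sq_nonneg (|y| / K - 1)]
    calc |y| = K * (|y| / K) := by field_simp
      _ ≤ _ := by gcongr; linarith
  have h2 := exp_half_mul_exp_half_le (u ^ 2 / S ^ 2) (y ^ 2 / K ^ 2)
  calc Real.exp u * |y| ≤ Real.exp (S ^ 2 / 2) * Real.exp (u ^ 2 / S ^ 2 / 2) *
        (K * Real.exp (y ^ 2 / K ^ 2 / 2)) := by
        gcongr
        exact exp_le_exp_half_mul hS u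
    _ = K * Real.exp (S ^ 2 / 2) *
        (Real.exp (u ^ 2 / S ^ 2 / 2) * Real.exp (y ^ 2 / K ^ 2 / 2)) := by ring
    _ ≤ K * Real.exp (S ^ 2 / 2) *
        ((Real.exp (u ^ 2 / S ^ 2) + Real.exp (y ^ 2 / K ^ 2)) / 2) := by gcongr
    _ = _ := by ring

variable {Ω : Type*} [MeasurableSpace Ω] {P : Measure Ω}

lemma integrable_and_integral_le_of_le {F f g : Ω → ℝ} {c : ℝ} (hc : 0 ≤ c)
    (hF : AEStronglyMeasurable F P) (hf : Integrable f P) (hg : Integrable g P)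
    (hf2 : ∫ ω, f ω ∂P ≤ 2) (hg2 : ∫ ω, g ω ∂P ≤ 2)
    (hF0 : ∀ᵐ ω ∂P, 0 ≤ F ω) (hFle : ∀ᵐ ω ∂P, F ω ≤ c * (f ω + g ω)) :
    Integrable F P ∧ ∫ ω, F ω ∂P ≤ 4 * c := by
  have hint : Integrable (fun ω => c * (f ω + g ω)) P := (hf.add hg).const_mul c
  have hFint : Integrable F P := by
    refine hint.mono' hF ?_
    filter_upwards [hF0, hFle] with ω h0 h1
    rwa [Real.norm_eq_abs, abs_of_nonneg h0]
  refine ⟨hFint, (integral_mono_ae hFint hint hFle).trans ?_⟩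
  rw [integral_const_mul, integral_add hf hg]
  nlinarith

end Moments

/-! ### Moments of the population score. -/

section Population

variable {Ω : Type*} [MeasurableSpace Ω] {P : Measure Ω} {p : ℕ}
  {R : Ω → ℝ} {X : Ω → Fin p → ℝ}

lemma integrable_of_zero_or_one [IsFiniteMeasure P] (hR : Measurable R) (h01 : ∀ᵐ ω ∂P, R ω = 0 ∨ R ω = 1) :
    Integrable R P := by
  refine Integrable.of_bound hR.aestronglyMeasurable 1 ?_
  filter_upwards [h01] with ω hω
  rcases hω with h | h <;> simp [h]

lemma integral_eq_measureReal_of_zero_or_one (hR : Measurable R)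
    (h01 : ∀ᵐ ω ∂P, R ω = 0 ∨ R ω = 1) : ∫ ω, R ω ∂P = P.real {ω | R ω = 1} := by
  have hs : MeasurableSet {ω | R ω = 1} := hR (measurableSet_singleton 1)
  rw [← integral_indicator_one hs]
  refine integral_congr_ae ?_
  filter_upwards [h01] with ω hω
  rcases hω with h | h <;> simp [Set.indicator, h]

/-- The model enters the moment computations through this identity: it centers the score and turns
the `R` part of its second moment into a `g` part. -/
lemma integral_mul_comp_eq_of_condExp_eq [IsFiniteMeasure P] {g h : (Fin p → ℝ) → ℝ} (hX : Measurable X)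
    (hRi : Integrable R P)
    (hmodel : P[R | MeasurableSpace.comap X inferInstance] =ᵐ[P] fun ω => g (X ω))
    (hh : Measurable h) (hint : Integrable (fun ω => R ω * h (X ω)) P) :
    ∫ ω, R ω * h (X ω) ∂P = ∫ ω, g (X ω) * h (X ω) ∂P := by
  have hle : MeasurableSpace.comap X inferInstance ≤ (inferInstance : MeasurableSpace Ω) :=
    hX.comap_le
  have hhX : StronglyMeasurable[MeasurableSpace.comap X inferInstance] fun ω => h (X ω) :=
    (hh.comp (comap_measurable X)).stronglyMeasurable
  have h1 := condExp_mul_of_stronglyMeasurable_right (μ := P) (f := R) hhX hint hRi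
  have h2 := integral_condExp (μ := P) (f := R * fun ω => h (X ω)) hle
  change _ = ∫ ω, R ω * h (X ω) ∂P at h2
  rw [← h2]
  refine integral_congr_ae ?_
  filter_upwards [h1, hmodel] with ω e1 e2
  rw [e1, Pi.mul_apply, e2]

variable {γ : EuclideanSpace ℝ (Fin (p + 1))} {a S K : ℝ} {j : Fin (p + 1)}

lemma integrable_and_integral_offsetPropensity_mul_sq_le (hX : Measurable X) (ha : 0 ≤ a)
    (hS : 0 < S) (hK : 0 < K)
    (hU : Integrable (fun ω => Real.exp (linPred γ (X ω) ^ 2 / S ^ 2)) P)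
    (hU2 : ∫ ω, Real.exp (linPred γ (X ω) ^ 2 / S ^ 2) ∂P ≤ 2)
    (hV : Integrable (fun ω => Real.exp (withIntercept (X ω) j ^ 2 / K ^ 2)) P)
    (hV2 : ∫ ω, Real.exp (withIntercept (X ω) j ^ 2 / K ^ 2) ∂P ≤ 2) :
    Integrable (fun ω => offsetPropensity a γ (X ω) * withIntercept (X ω) j ^ 2) P ∧
      ∫ ω, offsetPropensity a γ (X ω) * withIntercept (X ω) j ^ 2 ∂P ≤
        4 * (a * (K ^ 2 * Real.exp (S ^ 2 / 2))) := by
  have hgm := (measurable_offsetPropensity a γ).comp hX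
  have hwm := (measurable_withIntercept_apply j).comp hX
  refine integrable_and_integral_le_of_le (by positivity)
    (hgm.mul (hwm.pow_const 2)).aestronglyMeasurable hU hV hU2 hV2
    (.of_forall fun ω => mul_nonneg (offsetPropensity_nonneg ha _ _) (sq_nonneg _))
    (.of_forall fun ω => ?_)
  calc _ ≤ a * Real.exp (linPred γ (X ω)) * withIntercept (X ω) j ^ 2 := by
        gcongr
        exact offsetPropensity_le_mul_exp ha _ _
    _ = a * (Real.exp (linPred γ (X ω)) * withIntercept (X ω) j ^ 2) := by ring
    _ ≤ a * _ := mul_le_mul_of_nonneg_left (exp_mul_sq_le hS hK _ _) ha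
    _ = _ := by ring

lemma integrable_and_integral_offsetPropensity_mul_abs_le (hX : Measurable X) (ha : 0 ≤ a)
    (hS : 0 < S) (hK : 0 < K)
    (hU : Integrable (fun ω => Real.exp (linPred γ (X ω) ^ 2 / S ^ 2)) P)
    (hU2 : ∫ ω, Real.exp (linPred γ (X ω) ^ 2 / S ^ 2) ∂P ≤ 2)
    (hV : Integrable (fun ω => Real.exp (withIntercept (X ω) j ^ 2 / K ^ 2)) P)
    (hV2 : ∫ ω, Real.exp (withIntercept (X ω) j ^ 2 / K ^ 2) ∂P ≤ 2) :
    Integrable (fun ω => offsetPropensity a γ (X ω) * |withIntercept (X ω) j|) P ∧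
      ∫ ω, offsetPropensity a γ (X ω) * |withIntercept (X ω) j| ∂P ≤
        4 * (a * (K / 2 * Real.exp (S ^ 2 / 2))) := by
  have hgm := (measurable_offsetPropensity a γ).comp hX
  have hwm := (measurable_withIntercept_apply j).comp hX
  refine integrable_and_integral_le_of_le (by positivity)
    (hgm.mul (continuous_abs.measurable.comp hwm)).aestronglyMeasurable hU hV hU2 hV2
    (.of_forall fun ω => mul_nonneg (offsetPropensity_nonneg ha _ _) (abs_nonneg _))
    (.of_forall fun ω => ?_)
  calc _ ≤ a * Real.exp (linPred γ (X ω)) * |withIntercept (X ω) j| := by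
        gcongr
        exact offsetPropensity_le_mul_exp ha _ _
    _ = a * (Real.exp (linPred γ (X ω)) * |withIntercept (X ω) j|) := by ring
    _ ≤ a * _ := mul_le_mul_of_nonneg_left (exp_mul_abs_le hS hK _ _) ha
    _ = _ := by ring

lemma integrable_of_abs_le_of_exp_sq {F V : Ω → ℝ} (hF : AEStronglyMeasurable F P) (hK : 0 < K)
    (hV : Integrable (fun ω => Real.exp (V ω ^ 2 / K ^ 2)) P) (h : ∀ᵐ ω ∂P, |F ω| ≤ |V ω|) :
    Integrable F P := by
  refine (hV.const_mul K).mono' hF ?_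
  filter_upwards [h] with ω hω
  have h1 := Real.add_one_le_exp (V ω ^ 2 / K ^ 2)
  have h2 : |V ω| / K ≤ V ω ^ 2 / K ^ 2 + 1 := by
    rw [← sq_abs (V ω), ← div_pow]
    nlinarith [sq_nonneg (|V ω| / K - 1)]
  refine hω.trans ?_
  calc |V ω| = K * (|V ω| / K) := by field_simp
    _ ≤ _ := by gcongr; linarith

lemma integrable_and_integral_score [IsFiniteMeasure P] (hR : Measurable R) (hX : Measurable X)
    (h01 : ∀ᵐ ω ∂P, R ω = 0 ∨ R ω = 1) (ha : 0 ≤ a)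
    (hmodel : P[R | MeasurableSpace.comap X inferInstance]
      =ᵐ[P] fun ω => offsetPropensity a γ (X ω))
    (hS : 0 < S) (hK : 0 < K)
    (hU : Integrable (fun ω => Real.exp (linPred γ (X ω) ^ 2 / S ^ 2)) P)
    (hU2 : ∫ ω, Real.exp (linPred γ (X ω) ^ 2 / S ^ 2) ∂P ≤ 2)
    (hV : Integrable (fun ω => Real.exp (withIntercept (X ω) j ^ 2 / K ^ 2)) P)
    (hV2 : ∫ ω, Real.exp (withIntercept (X ω) j ^ 2 / K ^ 2) ∂P ≤ 2) :
    Integrable (fun ω => (R ω - offsetPropensity a γ (X ω)) * withIntercept (X ω) j) P ∧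
    ∫ ω, (R ω - offsetPropensity a γ (X ω)) * withIntercept (X ω) j ∂P = 0 ∧
    Integrable (fun ω => ((R ω - offsetPropensity a γ (X ω)) * withIntercept (X ω) j) ^ 2) P ∧
    ∫ ω, ((R ω - offsetPropensity a γ (X ω)) * withIntercept (X ω) j) ^ 2 ∂P ≤
      8 * (a * (K ^ 2 * Real.exp (S ^ 2 / 2))) := by
  have hgm : Measurable fun ω => offsetPropensity a γ (X ω) :=
    (measurable_offsetPropensity a γ).comp hX
  have hwm : Measurable fun ω => withIntercept (X ω) j := (measurable_withIntercept_apply j).comp hX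
  have hRi := integrable_of_zero_or_one hR h01
  have hR1 : ∀ᵐ ω ∂P, |R ω| ≤ 1 := by
    filter_upwards [h01] with ω hω
    rcases hω with h | h <;> simp [h]
  have hWi : Integrable (fun ω => withIntercept (X ω) j) P :=
    integrable_of_abs_le_of_exp_sq hwm.aestronglyMeasurable hK hV (.of_forall fun _ => le_rfl)
  have hRV : Integrable (fun ω => R ω * withIntercept (X ω) j) P :=
    hWi.bdd_mul hR.aestronglyMeasurable hR1
  have hgV : Integrable (fun ω => offsetPropensity a γ (X ω) * withIntercept (X ω) j) P := by
    refine hWi.bdd_mul (c := 1) hgm.aestronglyMeasurable (.of_forall fun ω => ?_)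
    rw [Real.norm_eq_abs, abs_of_nonneg (offsetPropensity_nonneg ha _ _)]
    exact offsetPropensity_le_one ha _ _
  obtain ⟨hg2, hg2le⟩ := integrable_and_integral_offsetPropensity_mul_sq_le (j := j) hX ha hS hK
    hU hU2 hV hV2
  have hV2i : Integrable (fun ω => withIntercept (X ω) j ^ 2) P := by
    refine (hV.const_mul (K ^ 2)).mono' (hwm.pow_const 2).aestronglyMeasurable
      (.of_forall fun ω => ?_)
    rw [Real.norm_eq_abs, abs_of_nonneg (sq_nonneg _)]
    have := Real.add_one_le_exp (withIntercept (X ω) j ^ 2 / K ^ 2)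
    calc withIntercept (X ω) j ^ 2 = K ^ 2 * (withIntercept (X ω) j ^ 2 / K ^ 2) := by field_simp
      _ ≤ _ := by gcongr; linarith
  have hR2 : Integrable (fun ω => R ω * withIntercept (X ω) j ^ 2) P :=
    hV2i.bdd_mul hR.aestronglyMeasurable hR1
  -- For `R ∈ {0, 1}` and `g ∈ [0, 1]` one has `(R - g)² ≤ R + g`. Both summands contribute the same
  -- integral, whence the factor `8` instead of `4`.
  have hdom : ∀ᵐ ω ∂P, ((R ω - offsetPropensity a γ (X ω)) * withIntercept (X ω) j) ^ 2 ≤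
      R ω * withIntercept (X ω) j ^ 2 +
        offsetPropensity a γ (X ω) * withIntercept (X ω) j ^ 2 := by
    filter_upwards [h01] with ω hω
    have h0 := offsetPropensity_nonneg ha γ (X ω)
    have h1 := offsetPropensity_le_one ha γ (X ω)
    rw [mul_pow, ← add_mul]
    refine mul_le_mul_of_nonneg_right ?_ (sq_nonneg _)
    rcases hω with h | h <;> rw [h] <;> nlinarith
  have hsqi : Integrable
      (fun ω => ((R ω - offsetPropensity a γ (X ω)) * withIntercept (X ω) j) ^ 2) P := by
    refine (hR2.add hg2).mono' (((hR.sub hgm).mul hwm).pow_const 2).aestronglyMeasurable ?_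
    filter_upwards [hdom] with ω hω
    rwa [Real.norm_eq_abs, abs_of_nonneg (sq_nonneg _)]
  refine ⟨(hRV.sub hgV).congr (.of_forall fun ω => (sub_mul _ _ _).symm), ?_, hsqi, ?_⟩
  · simp only [sub_mul]
    rw [integral_sub hRV hgV, integral_mul_comp_eq_of_condExp_eq hX hRi hmodel
      (measurable_withIntercept_apply j) hRV, sub_self]
  · refine (integral_mono_ae hsqi (hR2.add hg2) hdom).trans ?_
    simp only [Pi.add_apply]
    rw [integral_add hR2 hg2, integral_mul_comp_eq_of_condExp_eq
      (h := fun x => withIntercept x j ^ 2) hX hRi hmodel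
      ((measurable_withIntercept_apply j).pow_const 2) hR2]
    linarith

end Population

/-! ### Concentration of the score and of the labeling fraction. -/

section Sample

variable {Ω Ω' : Type*} [MeasurableSpace Ω] [MeasurableSpace Ω'] {P : Measure Ω} {P' : Measure Ω'}
  [IsProbabilityMeasure P] [IsProbabilityMeasure P'] {N p : ℕ}
  {R : Ω → ℝ} {X : Ω → Fin p → ℝ} {RS : Fin N → Ω' → ℝ} {XS : Fin N → Ω' → Fin p → ℝ}
  {γ : EuclideanSpace ℝ (Fin (p + 1))} {a S K τ : ℝ}

/-- Three Bernstein bounds: the score, its negative, and the weight `g |X(j)|`. All are dominated by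
`|X(j)|` and share one second-moment bound, hence one deviation `D`. -/
lemma measureReal_score_tail_le (hN : 1 ≤ N) (hR : Measurable R) (hX : Measurable X)
    (h01 : ∀ᵐ ω ∂P, R ω = 0 ∨ R ω = 1) (ha : 0 ≤ a)
    (hmodel : P[R | MeasurableSpace.comap X inferInstance]
      =ᵐ[P] fun ω => offsetPropensity a γ (X ω))
    (hindep : iIndepFun (fun i ω => (RS i ω, XS i ω)) P')
    (hident : ∀ i, IdentDistrib (fun ω => (RS i ω, XS i ω)) (fun ω => (R ω, X ω)) P' P)
    (hS : 0 < S) (hK : 0 < K)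
    (hU : Integrable (fun ω => Real.exp (linPred γ (X ω) ^ 2 / S ^ 2)) P)
    (hU2 : ∫ ω, Real.exp (linPred γ (X ω) ^ 2 / S ^ 2) ∂P ≤ 2) {j : Fin (p + 1)}
    (hV : Integrable (fun ω => Real.exp (withIntercept (X ω) j ^ 2 / K ^ 2)) P)
    (hV2 : ∫ ω, Real.exp (withIntercept (X ω) j ^ 2 / K ^ 2) ∂P ≤ 2) (hτ : 0 ≤ τ) {D : ℝ}
    (hD : N * D = 2 * √((2 * N * (8 * (a * (K ^ 2 * Real.exp (S ^ 2 / 2)))) + 2 * K ^ 2) * τ) +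
      K * √(8 * Real.log (2 * N)) * τ) :
    P'.real {ω | ¬(|∑ i, (RS i ω - offsetPropensity a γ (XS i ω)) * withIntercept (XS i ω) j|
        ≤ N * D ∧
      ∑ i, offsetPropensity a γ (XS i ω) * |withIntercept (XS i ω) j| ≤
        N * (4 * (a * (K / 2 * Real.exp (S ^ 2 / 2))) + D))} ≤ 3 * Real.exp (-τ) := by
  obtain ⟨hs1, hs0, hs2, hs2le⟩ := integrable_and_integral_score (j := j) hR hX h01 ha hmodel hS hK
    hU hU2 hV hV2
  obtain ⟨hg1, hg1le⟩ := integrable_and_integral_offsetPropensity_mul_abs_le (j := j) hX ha hS hK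
    hU hU2 hV hV2
  obtain ⟨hg2, hg2le⟩ := integrable_and_integral_offsetPropensity_mul_sq_le (j := j) hX ha hS hK
    hU hU2 hV hV2
  have hgm := measurable_offsetPropensity a γ
  have hwm := measurable_withIntercept_apply (p := p) j
  have hgle (x : Fin p → ℝ) := offsetPropensity_le_one ha γ x
  have hg0 (x : Fin p → ℝ) := offsetPropensity_nonneg ha γ x
  have hφm : Measurable fun z : ℝ × (Fin p → ℝ) =>
      (z.1 - offsetPropensity a γ z.2) * withIntercept z.2 j :=
    (measurable_fst.sub (hgm.comp measurable_snd)).mul (hwm.comp measurable_snd)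
  have hψm : Measurable fun z : ℝ × (Fin p → ℝ) =>
      offsetPropensity a γ z.2 * |withIntercept z.2 j| :=
    (hgm.comp measurable_snd).mul (continuous_abs.measurable.comp (hwm.comp measurable_snd))
  have hle1 : ∀ᵐ ω ∂P, |(R ω - offsetPropensity a γ (X ω)) * withIntercept (X ω) j| ≤
      |withIntercept (X ω) j| := by
    filter_upwards [h01] with ω hω
    rw [abs_mul]
    refine mul_le_of_le_one_left (abs_nonneg _) (abs_le.2 ?_)
    have h0 := hg0 (X ω)
    have h1 := hgle (X ω)
    rcases hω with h | h <;> rw [h] <;> constructor <;> linarith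
  have ht1 := measureReal_sum_comp_ge_le_of_subgaussian hN hindep hident hφm (m := 0)
    hK hV hV2 hle1 hs1 hs2 hs0.le hs2le hτ
  have ht2 := measureReal_sum_comp_ge_le_of_subgaussian hN hindep hident hφm.neg (m := 0)
    (v := 8 * (a * (K ^ 2 * Real.exp (S ^ 2 / 2))))
    hK hV hV2 (by simpa using hle1) hs1.neg (by simpa using hs2)
    (by simp [integral_neg, hs0]) (by simpa using hs2le) hτ
  have hv0 : 0 ≤ a * (K ^ 2 * Real.exp (S ^ 2 / 2)) := by positivity
  have hgsq (ω) : (offsetPropensity a γ (X ω) * |withIntercept (X ω) j|) ^ 2 ≤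
      offsetPropensity a γ (X ω) * withIntercept (X ω) j ^ 2 := by
    rw [mul_pow, sq_abs]
    refine mul_le_mul_of_nonneg_right ?_ (sq_nonneg _)
    nlinarith [hg0 (X ω), hgle (X ω)]
  have hgsqi : Integrable
      (fun ω => (offsetPropensity a γ (X ω) * |withIntercept (X ω) j|) ^ 2) P := by
    refine hg2.mono' ((hψm.comp (hR.prodMk hX)).pow_const 2).aestronglyMeasurable
      (.of_forall fun ω => ?_)
    rw [Real.norm_eq_abs, abs_of_nonneg (sq_nonneg _)]
    exact hgsq ω
  have ht3 := measureReal_sum_comp_ge_le_of_subgaussian hN hindep hident hψm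
    (v := 8 * (a * (K ^ 2 * Real.exp (S ^ 2 / 2)))) hK hV hV2
    (.of_forall fun ω => by
      rw [abs_mul, abs_abs, abs_of_nonneg (hg0 (X ω))]
      exact mul_le_of_le_one_left (abs_nonneg _) (hgle _))
    hg1 hgsqi hg1le ((integral_mono hgsqi hg2 hgsq).trans (by linarith)) hτ
  rw [← hD] at ht1 ht2 ht3
  refine (measureReal_mono (fun ω hω => ?_)).trans ((measureReal_union_le _ _).trans
    ((add_le_add ((measureReal_union_le _ _).trans (add_le_add ht1 ht2)) ht3).trans
      (le_of_eq (by ring))))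
  by_contra hcon
  simp only [Set.mem_union, Set.mem_ofPred_eq, not_or, not_le, mul_zero, zero_add,
    Finset.sum_neg_distrib, Pi.neg_apply] at hcon
  obtain ⟨⟨h1, h2⟩, h3⟩ := hcon
  exact hω ⟨abs_le.2 ⟨by linarith, h1.le⟩, by linarith⟩

lemma measureReal_labelFraction_tail_le (hN : 1 ≤ N) (hR : Measurable R)
    (h01 : ∀ᵐ ω ∂P, R ω = 0 ∨ R ω = 1)
    (hindep : iIndepFun (fun i ω => (RS i ω, XS i ω)) P')
    (hident : ∀ i, IdentDistrib (fun ω => (RS i ω, XS i ω)) (fun ω => (R ω, X ω)) P' P)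
    (ha : ∫ ω, R ω ∂P = a) (ha0 : 0 < a) {t : ℝ} (ht : 0 ≤ t) (hta : t < N * a) :
    P'.real {ω | ¬|labelFraction (fun i => RS i ω) - a| ≤ 2 * √(t / (N * a)) * a} ≤
      2 * Real.exp (-t) := by
  have hN' : (0 : ℝ) < N := by exact_mod_cast hN
  have hi := integrable_of_zero_or_one hR h01
  have h1 := measureReal_sum_bernoulli_ge_le hindep hident measurable_fst h01 hi ha ht hta
    (.inl rfl)
  have h2 := measureReal_sum_bernoulli_ge_le hindep hident measurable_fst h01 hi ha ht hta
    (.inr rfl)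
  refine (measureReal_mono (fun ω hω => ?_)).trans
    ((measureReal_union_le _ _).trans ((add_le_add h1 h2).trans (le_of_eq (by ring))))
  by_contra hcon
  simp only [Set.mem_union, Set.mem_ofPred_eq, not_or, not_le, ← Finset.mul_sum,
    Finset.sum_sub_distrib, Finset.sum_const, Finset.card_univ, Fintype.card_fin,
    nsmul_eq_mul] at hcon
  refine hω ?_
  have hsq : √(N * a * t) = N * (√(t / (N * a)) * a) := by
    rw [Real.sqrt_eq_iff_eq_sq (by positivity) (by positivity), mul_pow, mul_pow,
      Real.sq_sqrt (by positivity)]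
    field_simp
  have hlab : labelFraction (fun i => RS i ω) - a = (∑ i, RS i ω - N * a) / N := by
    rw [labelFraction]
    field_simp
  rw [hlab, abs_div, abs_of_pos hN', div_le_iff₀ hN']
  rw [hsq] at hcon
  exact abs_le.2 ⟨by linarith [hcon.2], by linarith [hcon.1]⟩

end Sample

/-! ### Comparison with the stated constants. -/

section Bound

/-- Splitting the sub-gamma deviation into its square-root and its linear part. -/
lemma subgamma_deviation_le {n a s σ τ L : ℝ} (hn : 0 < n) (ha : 0 ≤ a) (hσ : 0 ≤ σ) (hτ : 1 ≤ τ)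
    (hL : 1 / 4 ≤ L) :
    2 * √((2 * n * (8 * (a * ((2 * σ) ^ 2 * Real.exp ((s ^ 2 + 1) / 2)))) + 2 * (2 * σ) ^ 2) * τ)
        + 2 * σ * √(8 * L) * τ ≤
      n * (16 * σ * Real.exp ((s ^ 2 + 1) / 4) * √a * √(τ / n) + 27 * σ * (√L * τ / n)) := by
  have hτ0 : 0 ≤ τ := by linarith
  set e := Real.exp ((s ^ 2 + 1) / 4)
  have he : Real.exp ((s ^ 2 + 1) / 2) = e ^ 2 := by
    rw [← Real.exp_nat_mul]
    congr 1
    push_cast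
    ring
  have hepos : 0 < e := Real.exp_pos _
  have hqa := Real.sq_sqrt ha
  have hw : √(τ / n) ^ 2 = τ / n := Real.sq_sqrt (by positivity)
  have hL0 : 0 ≤ √L := Real.sqrt_nonneg L
  have hL2 : √L ^ 2 = L := Real.sq_sqrt (by linarith)
  have h1 : √((2 * n * (8 * (a * ((2 * σ) ^ 2 * e ^ 2))) + 2 * (2 * σ) ^ 2) * τ) ≤
      n * (8 * σ * e * √a * √(τ / n)) + 3 * σ * τ := by
    refine Real.sqrt_le_iff.2 ⟨by positivity, ?_⟩
    have h2 : (n * (8 * σ * e * √a * √(τ / n))) ^ 2 = 64 * n * σ ^ 2 * e ^ 2 * a * τ := by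
      simp only [mul_pow, hqa, hw]
      field_simp
      ring
    have h3 : 0 ≤ n * (8 * σ * e * √a * √(τ / n)) * (3 * σ * τ) := by positivity
    -- Since `τ ≥ 1`, the truncation remainder under the root is absorbed into the linear term.
    have h4 : σ ^ 2 * τ ≤ σ ^ 2 * τ ^ 2 := by
      gcongr
      nlinarith
    have h5 : 0 ≤ σ ^ 2 * τ ^ 2 := by positivity
    nlinarith
  have hLh : 1 / 2 ≤ √L := Real.le_sqrt_of_sq_le (by linarith)
  have h8 : √(8 * L) ≤ 3 * √L := by
    refine Real.sqrt_le_iff.2 ⟨by positivity, ?_⟩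
    rw [mul_pow, hL2]
    linarith
  have h9 : 2 * σ * √(8 * L) * τ ≤ 2 * σ * (3 * √L) * τ := by gcongr
  have h10 : σ * τ ≤ 2 * (σ * √L * τ) := by
    nlinarith [mul_nonneg hσ hτ0]
  have h11 : 0 ≤ σ * √L * τ := by positivity
  rw [he]
  have h12 : n * (16 * σ * e * √a * √(τ / n) + 27 * σ * (√L * τ / n)) =
      2 * (n * (8 * σ * e * √a * √(τ / n))) + 27 * (σ * √L * τ) := by
    field_simp
    ring
  rw [h12]
  linarith

lemma le_gradBound {N p : ℕ} {a s σ t₁ t₂ D : ℝ} (hN : 0 < N) (ha : 0 < a) (hs : 0 ≤ s)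
    (hσ : 1 ≤ σ) (hτ : 0 ≤ t₁ + Real.log ((p : ℝ) + 1)) (ht₂ : 0 ≤ t₂) (hta : t₂ < N * a / 9)
    (hD : D ≤ 16 * σ * Real.exp ((s ^ 2 + 1) / 4) * √a *
      √((t₁ + Real.log ((p : ℝ) + 1)) / N) +
      27 * σ * (√(Real.log (2 * (N : ℝ))) * (t₁ + Real.log ((p : ℝ) + 1)) / N))
    (hD0 : 0 ≤ D) :
    D + 2 * √(t₂ / (N * a)) * (4 * (a * (2 * σ / 2 * Real.exp ((s ^ 2 + 1) / 2))) + D) ≤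
      gradBound 10 s σ N p a t₁ t₂ := by
  have hn : (0 : ℝ) < N := by exact_mod_cast hN
  set n : ℝ := (N : ℝ)
  set τ := t₁ + Real.log ((p : ℝ) + 1)
  set L := √(Real.log (2 * n))
  have hL : 0 ≤ L := Real.sqrt_nonneg _
  -- This is where the `9` in the range of `t₂` is needed; it yields the factor `1 + 2/3 = 5/3` in
  -- `e2`.
  have hδ : √(t₂ / (n * a)) ≤ 1 / 3 := by
    refine Real.sqrt_le_iff.2 ⟨by norm_num, ?_⟩
    rw [div_le_iff₀ (by positivity)]
    linarith
  have hδa : √(t₂ / (n * a)) * a = √(t₂ * a / n) := by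
    symm
    rw [Real.sqrt_eq_iff_eq_sq (by positivity) (by positivity), mul_pow,
      Real.sq_sqrt (by positivity)]
    field_simp
  have hσexp : σ ≤ Real.exp (σ ^ 2) := by
    have := Real.add_one_le_exp (σ ^ 2)
    nlinarith [sq_nonneg (σ - 1)]
  have hC1 : 16 * 5 / 3 * σ * Real.exp ((s ^ 2 + 1) / 4) ≤ gradC1 s σ := by
    have h1 : σ * Real.exp ((s ^ 2 + 1) / 4) ≤ Real.exp (2 * s + 80 * s ^ 2 + 5 * σ ^ 2) := by
      calc σ * Real.exp ((s ^ 2 + 1) / 4) ≤ Real.exp (σ ^ 2) * Real.exp ((s ^ 2 + 1) / 4) := by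
            gcongr
        _ = Real.exp (σ ^ 2 + (s ^ 2 + 1) / 4) := (Real.exp_add _ _).symm
        _ ≤ _ := Real.exp_le_exp.2 (by nlinarith)
    have := Real.exp_pos (2 * s + 80 * s ^ 2 + 5 * σ ^ 2)
    rw [gradC1]
    linarith
  have hC4 : 8 * (σ * Real.exp ((s ^ 2 + 1) / 2)) ≤ gradC4 s σ := by
    have h1 : σ * Real.exp ((s ^ 2 + 1) / 2) ≤ Real.exp (2 * s + 40 * s ^ 2 + 10 * σ ^ 2) := by
      calc σ * Real.exp ((s ^ 2 + 1) / 2) ≤ Real.exp (σ ^ 2) * Real.exp ((s ^ 2 + 1) / 2) := by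
            gcongr
        _ = Real.exp (σ ^ 2 + (s ^ 2 + 1) / 2) := (Real.exp_add _ _).symm
        _ ≤ _ := Real.exp_le_exp.2 (by nlinarith)
    have h2 : (1 : ℝ) ≤ √2 := Real.one_le_sqrt.2 (by norm_num)
    have h3 := Real.exp_pos (2 * s + 40 * s ^ 2 + 10 * σ ^ 2)
    rw [gradC4]
    nlinarith
  have hC10 : 0 ≤ gradC1 s σ := by unfold gradC1; positivity
  have hC40 : 0 ≤ gradC4 s σ := by unfold gradC4; positivity
  have hC30 : 0 ≤ gradC3 s σ := by unfold gradC3; positivity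
  have e1 : 2 * √(t₂ / (n * a)) * (4 * (a * (2 * σ / 2 * Real.exp ((s ^ 2 + 1) / 2)))) ≤
      gradC4 s σ * (√(t₂ * a / n) + t₂ / n) := by
    calc _ = 8 * (σ * Real.exp ((s ^ 2 + 1) / 2)) * (√(t₂ / (n * a)) * a) := by ring
      _ ≤ gradC4 s σ * (√(t₂ / (n * a)) * a) := by gcongr
      _ ≤ _ := by
        rw [hδa]
        gcongr
        have : 0 ≤ t₂ / n := by positivity
        linarith
  have e2 : D + 2 * √(t₂ / (n * a)) * D ≤ 5 / 3 * D := by nlinarith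
  have e3 : 16 * 5 / 3 * σ * Real.exp ((s ^ 2 + 1) / 4) * (√a * √(τ / n)) ≤
      gradC1 s σ * (a + √a) * √(τ / n) := by
    calc _ ≤ gradC1 s σ * (√a * √(τ / n)) := by gcongr
      _ = gradC1 s σ * √a * √(τ / n) := by ring
      _ ≤ _ := by
        gcongr
        linarith
  -- `45 = 27 · 5/3 = (9/2) · 10`, so the absolute constant can be `10`.
  have e4 : 45 * σ * (L * τ / n) ≤ (gradC2 10 σ + gradC3 s σ * a) * (L * τ / n) := by
    gcongr
    rw [gradC2]
    have := mul_nonneg hC30 ha.le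
    linarith
  have e5 : 0 ≤ L * τ / n := by positivity
  rw [gradBound]
  nlinarith

end Bound

/-! ### The union bound. -/

theorem mainTheorem10 :
    -- one absolute constant, before every other quantifier
    ∃ c₆ : ℝ, 0 < c₆ ∧
      ∀ {Ω Ω' : Type*} [MeasurableSpace Ω] [MeasurableSpace Ω']
        -- the population `(R, X)` and the space that carries the sample
        (P : Measure Ω) [IsProbabilityMeasure P] (P' : Measure Ω') [IsProbabilityMeasure P']
        (N p : ℕ) (R : Ω → ℝ) (X : Ω → Fin p → ℝ)
        (RS : Fin N → Ω' → ℝ) (XS : Fin N → Ω' → Fin p → ℝ)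
        (γ₀ : EuclideanSpace ℝ (Fin (p + 1))) (σγ σ : ℝ≥0) (t₁ t₂ : ℝ),
        Measurable R → Measurable X →
        (∀ᵐ ω ∂P, R ω = 0 ∨ R ω = 1) →
        -- the offset logistic model, `E(R | X) = π_N(X)` with `π_N = P(R = 1)`
        (P[R | MeasurableSpace.comap X inferInstance]
          =ᵐ[P] fun ω => offsetPropensity (P.real {ω | R ω = 1}) γ₀ (X ω)) →
        -- the sample consists of independent copies of `(R, X)`
        iIndepFun (fun i ω => (RS i ω, XS i ω)) P' →
        (∀ i, IdentDistrib (fun ω => (RS i ω, XS i ω)) (fun ω => (R ω, X ω)) P' P) →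
        -- sub-Gaussianity
        psi2Norm P (fun ω => linPred γ₀ (X ω)) ≤ σγ →
        (∀ j : Fin (p + 1), psi2Norm P (fun ω => withIntercept (X ω) j) ≤ σ) →
        0 ≤ t₁ → 0 ≤ t₂ → t₂ < N * P.real {ω | R ω = 1} / 9 →
        1 - 6 * Real.exp (-t₁) - 2 * Real.exp (-t₂) ≤
          P'.real {ω | gradSupNorm (fun i => RS i ω) (fun i => XS i ω) γ₀
            ≤ gradBound c₆ σγ σ N p (P.real {ω | R ω = 1}) t₁ t₂} := by
  refine ⟨10, by norm_num, ?_⟩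
  intro Ω Ω' _ _ P _ P' _ N p R X RS XS γ₀ σγ σ t₁ t₂ hR hX h01 hmodel hindep hident hlin hcoord
    ht₁ ht₂ hta
  have hmean := integral_eq_measureReal_of_zero_or_one hR h01
  set a := P.real {ω | R ω = 1}
  have hNa : 0 < N * a := by linarith
  have hN : 0 < N := Nat.pos_of_ne_zero (by rintro rfl; simp at hNa)
  have hN' : (0 : ℝ) < N := by exact_mod_cast hN
  have hN1 : (1 : ℝ) ≤ N := by exact_mod_cast hN
  have ha : 0 < a := pos_of_mul_pos_right hNa hN'.le
  by_cases ht₁' : 1 ≤ 6 * Real.exp (-t₁)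
  · have := Real.exp_pos (-t₂)
    exact le_trans (by linarith) measureReal_nonneg
  -- Otherwise `6 exp(-t₁) ≥ 6 / e > 1` and the claim is vacuous.
  have ht₁1 : 1 ≤ t₁ := by
    by_contra! h
    have h1 : Real.exp (-1) ≤ Real.exp (-t₁) := Real.exp_le_exp.2 (by linarith)
    have h2 := Real.exp_neg_one_gt_d9
    linarith
  have hlogp : 0 ≤ Real.log ((p : ℝ) + 1) := Real.log_nonneg (by linarith [p.cast_nonneg (α := ℝ)])
  set τ := t₁ + Real.log ((p : ℝ) + 1) with hτdef
  have hτ : 1 ≤ τ := by linarith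
  have hσ : (1 : ℝ) ≤ σ := by
    have h1 := one_le_psi2Norm_one (P := P)
    have h2 := h1.trans (hcoord 0)
    exact_mod_cast h2
  -- Both scales must strictly exceed the norm bounds. As `σγ` may vanish, its square is increased
  -- by one; as `σ ≥ 1`, doubling suffices for the coordinates.
  have hS : 0 < √((σγ : ℝ) ^ 2 + 1) := by positivity
  have hS2 : √((σγ : ℝ) ^ 2 + 1) ^ 2 = (σγ : ℝ) ^ 2 + 1 := Real.sq_sqrt (by positivity)
  have hK : 0 < 2 * (σ : ℝ) := by linarith
  have hUlt : psi2Norm P (fun ω => linPred γ₀ (X ω)) < ENNReal.ofReal √((σγ : ℝ) ^ 2 + 1) := by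
    refine hlin.trans_lt ?_
    rw [← ENNReal.ofReal_coe_nnreal, ENNReal.ofReal_lt_ofReal_iff hS]
    exact Real.lt_sqrt_of_sq_lt (by linarith)
  have hVlt (j) : psi2Norm P (fun ω => withIntercept (X ω) j) < ENNReal.ofReal (2 * (σ : ℝ)) := by
    refine (hcoord j).trans_lt ?_
    rw [← ENNReal.ofReal_coe_nnreal, ENNReal.ofReal_lt_ofReal_iff hK]
    linarith
  have hUm : AEMeasurable (fun ω => linPred γ₀ (X ω)) P :=
    ((measurable_linPred γ₀).comp hX).aemeasurable
  have hVm (j) : AEMeasurable (fun ω => withIntercept (X ω) j) P :=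
    ((measurable_withIntercept_apply j).comp hX).aemeasurable
  set Q := 2 * √((2 * N * (8 * (a * ((2 * (σ : ℝ)) ^ 2 *
      Real.exp (√((σγ : ℝ) ^ 2 + 1) ^ 2 / 2)))) + 2 * (2 * (σ : ℝ)) ^ 2) * τ) +
      2 * (σ : ℝ) * √(8 * Real.log (2 * N)) * τ with hQ
  have hND : N * (Q / N) = Q := mul_div_cancel₀ _ hN'.ne'
  have htail (j) := measureReal_score_tail_le (j := j) (τ := τ) hN hR hX h01 ha.le hmodel hindep
    hident hS hK (integrable_exp_sq_div_of_psi2Norm_lt hUm hUlt)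
    (integral_exp_sq_div_le_two_of_psi2Norm_lt hUm hUlt)
    (integrable_exp_sq_div_of_psi2Norm_lt (hVm j) (hVlt j))
    (integral_exp_sq_div_le_two_of_psi2Norm_lt (hVm j) (hVlt j)) (by linarith) (hND.trans hQ)
  have hfrac := measureReal_labelFraction_tail_le hN hR h01 hindep hident hmean ha ht₂
    (by linarith)
  rw [hS2] at htail hQ
  have hlog : 1 / 4 ≤ Real.log (2 * N) := by
    have := Real.log_le_log (by norm_num) (show (2 : ℝ) ≤ 2 * N by linarith)
    linarith [Real.log_two_gt_d9]
  have hQ0 : 0 ≤ Q := by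
    rw [hQ]; positivity
  have hDle := subgamma_deviation_le (s := σγ) hN' ha.le (zero_le_one.trans hσ) hτ hlog
  rw [← hQ, ← div_le_iff₀' hN'] at hDle
  have hbound := le_gradBound hN ha σγ.2 hσ (by linarith) ht₂ hta hDle (by positivity)
  -- The gradient formula needs a nonnegative estimated offset, which holds only almost surely.
  have hnull : ∀ᵐ ω ∂P', ∀ i, RS i ω = 0 ∨ RS i ω = 1 := by
    rw [ae_all_iff]
    intro i
    have hmeas : MeasurableSet {x : ℝ × (Fin p → ℝ) | x.1 = 0 ∨ x.1 = 1} :=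
      (measurableSet_eq_fun measurable_fst measurable_const).union
        (measurableSet_eq_fun measurable_fst measurable_const)
    exact (hident i).symm.ae_snd (p := fun x => x.1 = 0 ∨ x.1 = 1) hmeas h01
  have hall := (measureReal_iUnion_fintype_le (μ := P') _).trans
    (Finset.sum_le_sum fun j (_ : j ∈ Finset.univ) => htail j)
  -- The summand `log (p + 1)` of `τ` cancels the number of coordinates.
  have hsum : ∑ _j : Fin (p + 1), 3 * Real.exp (-τ) = 3 * Real.exp (-t₁) := by
    rw [hτdef, neg_add, Real.exp_add, Real.exp_neg (Real.log _), Real.exp_log (by positivity)]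
    simp
    field_simp
  rw [hsum] at hall
  have hnull0 : P'.real {ω | ¬∀ i, RS i ω = 0 ∨ RS i ω = 1} = 0 := by
    rw [measureReal_def, ae_iff.1 hnull, ENNReal.toReal_zero]
  have hcover : P'.real Set.univ ≤ P'.real {ω | gradSupNorm (fun i => RS i ω) (fun i => XS i ω) γ₀
      ≤ gradBound 10 σγ σ N p a t₁ t₂} + 3 * Real.exp (-t₁) + 2 * Real.exp (-t₂) + 0 := by
    rw [← hnull0]
    refine le_trans (measureReal_mono (fun ω _ => ?_)) ((measureReal_union_le _ _).trans
      (add_le_add_left ((measureReal_union_le _ _).trans (add_le_add ((measureReal_union_le _ _).trans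
        (add_le_add_right hall _)) hfrac)) _))
    by_contra hcon
    simp only [Set.mem_union, Set.mem_iUnion, Set.mem_ofPred_eq, not_or, not_exists,
      not_not] at hcon
    obtain ⟨⟨⟨h1, h2⟩, h3⟩, h4⟩ := hcon
    refine h1 ((gradSupNorm_le ?_ fun j => ?_).trans hbound)
    · unfold labelFraction
      refine mul_nonneg (by positivity) (Finset.sum_nonneg fun i _ => ?_)
      rcases h4 i with h | h <;> simp [h]
    · refine abs_score_le hN ?_ ha (h2 j).1 (h2 j).2 h3
      unfold labelFraction
      refine mul_nonneg (by positivity) (Finset.sum_nonneg fun i _ => ?_)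
      rcases h4 i with h | h <;> simp [h]
  rw [probReal_univ] at hcover
  linarith [Real.exp_pos (-t₁)]
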